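/- A problem is a partial multi-valued function $f:\subseteq\mathbb{N}^{\mathbb N}\rightrightarrows\mathbb{N}^{\mathbb N}$, i.e. a map assigning to each $p\in\mathbb{N}^{\mathbb N}$ a (possibly empty) set $f(p)\subseteq\mathbb{N}^{\mathbb N}$, with $\operatorname{dom}(f)=\{p: f(p)\neq\emptyset\}$; $\emptyset$ denotes the problem with empty domain. Let $(\Phi_e)_{e\in\mathbb N}$ be a standard computable enumeration of the partial computable functionals from $\mathbb{N}^{\mathbb N}$ to $\mathbb{N}^{\mathbb N}$; functionals are applied to pairs $(p,q)$ via the join of $p$ and $q$. For problems $f,g$, write $f\le_{\mathrm W} g$ ($f$ is Weihrauch reducible to $g$) if there are partial computable functionals $\Phi,\Psi$ such that for every $p\in\operatorname{dom}(f)$ we have $\Phi(p)\in\operatorname{dom}(g)$ and, for every $q\in g(\Phi(p))$, $\Psi(p,q)\in f(p)$; write $f<_{\mathrm W}g$ if $f\le_{\mathrm W}g$ and $g\not\le_{\mathrm W}f$. The totalizing jump $\mathsf{tJ}(f)$ of a problem $f$ is the problem whose inputs are all triples $(e,i,p)\in\mathbb N\times\mathbb N\times\mathbb{N}^{\mathbb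 N}$ (coded as elements of $\mathbb{N}^{\mathbb N}$), with \[ \mathsf{tJ}(f)(e,i,p)=\begin{cases}\{\Phi_i(p,q): q\in f(\Phi_e(p))\} & \text{if }\Phi_e(p)\in\operatorname{dom}(f)\text{ and }\Phi_i(p,q)\text{ is defined for all }q\in f(\Phi_e(p)),\\ \mathbb{N}^{\mathbb N} & \text{otherwise.}\end{cases} \] Theorem. For every problem $g\neq\emptyset$ there is a problem $f$ with $f<_{\mathrm W}g$ and $\mathsf{tJ}(f)\not\le_{\mathrm W}g$. That is, no nontrivial lower cone of the Weihrauch degrees is closed under the totalizing jump. -/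

import Mathlib

namespace Weihrauch

/-- Baire space, the set of all infinite sequences of natural numbers. -/
abbrev Baire : Type := ℕ → ℕ

/-- The finite prefix `p(0), …, p(l-1)` of `p`. -/
def initSeg (p : Baire) (l : ℕ) : List ℕ := (List.range l).map p

/-- The `n`-th digit of the output of the `e`-th partial computable functional on input `p`.
The `e`-th program is run on all pairs (finite prefix of `p`, `n`); pairs (length of the prefix,
number of steps) are dovetailed, and the first result that is found is the digit. If the program
halts on no such pair, the digit is undefined. -/
def digit (e : ℕ) (p : Baire) (n : ℕ) : Part ℕ :=
  Nat.rfindOpt fun t =>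
    Nat.Partrec.Code.evaln t.unpair.2 (Denumerable.ofNat Nat.Partrec.Code e)
      (Nat.pair (Encodable.encode (initSeg p t.unpair.1)) n)

/-- The enumeration of the partial computable functionals from Baire space to Baire space.
`Phi e p` is defined iff all output digits are defined. -/
def Phi (e : ℕ) (p : Baire) : Part Baire where
  Dom := ∀ n, (digit e p n).Dom
  get h := fun n => (digit e p n).get (h n)

/-- The join of two points of Baire space, used to give two inputs to a functional:
`p` on the even positions and `q` on the odd positions. -/
def join (p q : Baire) : Baire := fun n => if n % 2 = 0 then p (n / 2) else q (n / 2)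

/-- A (computational) problem: a partial multi-valued function on Baire space, as the map that
sends an input to its set of solutions, which is empty iff the input is not in the domain. -/
abbrev Problem : Type := Baire → Set Baire

/-- The domain of a partial multi-valued function. -/
def dom (f : Problem) : Set Baire := {p | (f p).Nonempty}

/-- The problem with empty domain. -/
def emptyProblem : Problem := fun _ => ∅

/-- Weihrauch reducibility, with forward functional `Phi e` and backward functional `Phi i`. -/
def Reducible (f g : Problem) : Prop :=
  ∃ e i : ℕ, ∀ p ∈ dom f,
    ∃ r ∈ Phi e p, r ∈ dom g ∧ ∀ q ∈ g r, ∃ s ∈ Phi i (join p q), s ∈ f p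

/-- Strict Weihrauch reducibility. -/
def StrictReducible (f g : Problem) : Prop := Reducible f g ∧ ¬ Reducible g f

open scoped Classical in
/-- The set of solutions of the totalizing jump of `f` on the input `(e, i, p)`. -/
noncomputable def totJumpAt (f : Problem) (e i : ℕ) (p : Baire) : Set Baire :=
  if ∃ r ∈ Phi e p, r ∈ dom f ∧ ∀ q ∈ f r, (Phi i (join p q)).Dom then
    {y | ∃ r ∈ Phi e p, ∃ q ∈ f r, y ∈ Phi i (join p q)}
  else Set.univ

/-- The totalizing jump of `f`, as a problem on Baire space: the triple `(e, i, p)` is coded by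
the sequence `e, i, p(0), p(1), …`. -/
noncomputable def totJump (f : Problem) : Problem :=
  fun x => totJumpAt f (x 0) (x 1) (fun n => x (n + 2))

end Weihrauch

namespace Weihrauch

open Nat.Partrec (Code)

/-! Fix `r₀ ∈ dom g` and a sequence `y` that `r₀` does not compute as the even half of any output.
Let `f = tagged y g` demand `y` along with each input of `g`. Then `f ≤ g` by discarding `y`, while
`g ≤ f` would make `r₀` compute `y` (`not_reducible_tagged`). If `tJ(f) ≤ g` via `a`, `b`, an input
`x = (e, i, p)` is built so that `Φ_e(p)` is the join of `y` with `Φ_a(x)` and `Φ_i(p, q)` is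
`Φ_b(x, q)` with one added to every digit. Every answer `Φ_b(x, q)` would then be the successor of
another such answer, an infinite descent (`not_totJump_tagged_reducible`). No recursion theorem is
needed: `p` itself carries `e` and `i`, so `x` is recovered from `p` by repeating its head. -/

theorem mem_rfindOpt_iff_least {f : ℕ → Option ℕ} {v : ℕ} :
    v ∈ Nat.rfindOpt f ↔ ∃ t, v ∈ f t ∧ ∀ t' < t, f t' = none := by
  rw [Nat.rfindOpt, Part.mem_bind_iff]
  constructor
  · rintro ⟨t, h, h3⟩
    exact ⟨t, Part.mem_coe.1 h3, fun t' ht' => by simpa using (Nat.mem_rfind.1 h).2 ht'⟩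
  · rintro ⟨t, h1, h2⟩
    refine ⟨t, Nat.mem_rfind.2 ⟨?_, fun {t'} ht' => by simp [h2 t' ht']⟩, Part.mem_coe.2 h1⟩
    simp [Option.mem_def.1 h1]

theorem mem_digit_iff_least {e : ℕ} {p : Baire} {n v : ℕ} :
    v ∈ digit e p n ↔ ∃ t : ℕ, v ∈ Code.evaln t.unpair.2 (Denumerable.ofNat Code e)
        (Nat.pair (Encodable.encode (initSeg p t.unpair.1)) n) ∧
      ∀ t' : ℕ, t' < t → Code.evaln t'.unpair.2 (Denumerable.ofNat Code e)
        (Nat.pair (Encodable.encode (initSeg p t'.unpair.1)) n) = none :=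
  mem_rfindOpt_iff_least

/-! ### Constructing indices of functionals -/

/-- A partial recursive procedure on finite prefixes all of whose answers are correct, and which
answers on some prefix whenever the digit is defined, yields an index of a functional. -/
theorem exists_index {F : Baire → ℕ → Part ℕ} {G : List ℕ × ℕ →. ℕ} (hG : Partrec G)
    (sound : ∀ x n l v, v ∈ G (initSeg x l, n) → v ∈ F x n)
    (complete : ∀ x n v, v ∈ F x n → ∃ l, v ∈ G (initSeg x l, n)) :
    ∃ e, ∀ x n, digit e x n = F x n := by
  obtain ⟨c, hc⟩ := Code.exists_code.1 hG
  have hev : ∀ σ n v, v ∈ c.eval (Nat.pair (Encodable.encode σ) n) ↔ v ∈ G (σ, n) := by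
    intro σ n v
    have : Nat.pair (Encodable.encode σ) n = Encodable.encode (σ, n) := rfl
    rw [hc, this]
    simp
  have hs : ∀ x n v, v ∈ digit (Encodable.encode c) x n → v ∈ F x n := by
    intro x n v hv
    obtain ⟨t, ht, -⟩ := mem_digit_iff_least.1 hv
    rw [Denumerable.ofNat_encode] at ht
    exact sound x n _ v ((hev _ _ _).1 (Code.evaln_sound ht))
  refine ⟨Encodable.encode c, fun x n => Part.ext fun v => ⟨hs x n v, fun hv => ?_⟩⟩
  obtain ⟨l, hl⟩ := complete x n v hv
  obtain ⟨k, hk⟩ := Code.evaln_complete.1 ((hev _ _ _).2 hl)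
  -- The dovetailed search may stop at a different stage; soundness and single-valuedness of `F`
  -- still force the answer `v`.
  have hdom : (digit (Encodable.encode c) x n).Dom := by
    refine Nat.rfindOpt_dom.2 ⟨Nat.pair l k, v, ?_⟩
    simpa using hk
  have hw := Part.get_mem hdom
  rwa [← Part.mem_unique (hs x n _ hw) hv]

/-- The prefix of `x ∘ m` computed from a prefix of `x`, for a reindexing `m` with `m n ≤ n`. -/
def reindexSeg (m : ℕ → ℕ) (σ : List ℕ) (l : ℕ) : List ℕ :=
  (List.range l).map fun j => σ.getD (m j) 0

theorem initSeg_getD (x : Baire) {l j : ℕ} (h : j < l) : (initSeg x l).getD j 0 = x j := by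
  simp [initSeg, List.getD, h]

theorem length_initSeg (x : Baire) (l : ℕ) : (initSeg x l).length = l := by simp [initSeg]

theorem mem_getElem_initSeg {x : Baire} {l j v : ℕ} :
    v ∈ (initSeg x l)[j]? ↔ j < l ∧ x j = v := by
  simp only [initSeg, List.getElem?_map, Option.mem_def, Option.map_eq_some_iff,
    List.getElem?_eq_some_iff, List.length_range, List.getElem_range]
  constructor
  · rintro ⟨_, ⟨h, rfl⟩, rfl⟩; exact ⟨h, rfl⟩
  · rintro ⟨h, rfl⟩; exact ⟨j, ⟨h, rfl⟩, rfl⟩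

theorem reindexSeg_initSeg {m : ℕ → ℕ} (hm : ∀ n, m n ≤ n) (x : Baire) {l k : ℕ} (h : k ≤ l) :
    reindexSeg m (initSeg x l) k = initSeg (x ∘ m) k := by
  refine List.map_congr_left fun j hj => ?_
  exact initSeg_getD x ((hm j).trans_lt ((List.mem_range.1 hj).trans_le h))

/-- Simulation of the `a`-th functional on `x ∘ m` as far as a prefix of `x` permits. -/
def simulate (a : ℕ) (m : ℕ → ℕ) (z : List ℕ × ℕ) : Part ℕ :=
  -- Stage `t` inspects a prefix of length at most `t`, so for `m n ≤ n` this guard keeps the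
  -- default `0` of `reindexSeg` from being read.
  Nat.rfindOpt fun t => bif decide (t ≤ z.1.length) then
    Code.evaln t.unpair.2 (Denumerable.ofNat Code a)
      (Nat.pair (Encodable.encode (reindexSeg m z.1 t.unpair.1)) z.2) else none

theorem partrec_simulate (a : ℕ) {m : ℕ → ℕ} (hm : Primrec m) : Partrec (simulate a m) := by
  have hseg : Primrec₂ (reindexSeg m) := by
    refine Primrec.list_map (Primrec.list_range.comp Primrec.snd) ?_
    exact (Primrec.list_getD 0).comp (Primrec.fst.comp Primrec.fst) (hm.comp Primrec.snd)
  refine Partrec.rfindOpt (Primrec.to_comp ?_)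
  refine Primrec.cond ?_ ?_ (Primrec.const none)
  · exact Primrec.nat_le.decide.comp Primrec.snd
      (Primrec.list_length.comp (Primrec.fst.comp Primrec.fst))
  · refine Code.primrec_evaln.comp (Primrec.pair (Primrec.pair ?_ (Primrec.const _)) ?_)
    · exact Primrec.snd.comp (Primrec.unpair.comp Primrec.snd)
    · refine Primrec₂.natPair.comp (Primrec.encode.comp ?_) (Primrec.snd.comp Primrec.fst)
      exact hseg.comp (Primrec.fst.comp Primrec.fst)
        (Primrec.fst.comp (Primrec.unpair.comp Primrec.snd))

theorem mem_simulate {a : ℕ} {m : ℕ → ℕ} {σ : List ℕ} {n v : ℕ} :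
    v ∈ simulate a m (σ, n) ↔ ∃ t ≤ σ.length, v ∈ Code.evaln t.unpair.2 (Denumerable.ofNat Code a)
        (Nat.pair (Encodable.encode (reindexSeg m σ t.unpair.1)) n) ∧
      ∀ t' < t, Code.evaln t'.unpair.2 (Denumerable.ofNat Code a)
        (Nat.pair (Encodable.encode (reindexSeg m σ t'.unpair.1)) n) = none := by
  rw [simulate, mem_rfindOpt_iff_least]
  constructor
  · rintro ⟨t, h1, h2⟩
    by_cases htl : t ≤ σ.length
    · exact ⟨t, htl, by simpa [htl] using h1,
        fun t' ht' => by simpa [ht'.le.trans htl] using h2 t' ht'⟩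
    · simp [htl] at h1
  · rintro ⟨t, htl, h1, h2⟩
    exact ⟨t, by simpa [htl] using h1, fun t' ht' => by simp [h2 t' ht']⟩

theorem simulate_sound {a : ℕ} {m : ℕ → ℕ} (hm : ∀ n, m n ≤ n) {x : Baire} {l n v : ℕ}
    (h : v ∈ simulate a m (initSeg x l, n)) : v ∈ digit a (x ∘ m) n := by
  obtain ⟨t, htl, h1, h2⟩ := mem_simulate.1 h
  rw [length_initSeg] at htl
  refine mem_digit_iff_least.2 ⟨t, ?_, fun t' ht' => ?_⟩
  · rwa [reindexSeg_initSeg hm x ((Nat.unpair_left_le t).trans htl)] at h1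
  · have := h2 t' ht'
    rwa [reindexSeg_initSeg hm x ((Nat.unpair_left_le t').trans (ht'.le.trans htl))] at this

theorem simulate_complete {a : ℕ} {m : ℕ → ℕ} (hm : ∀ n, m n ≤ n) {x : Baire} {n v : ℕ}
    (h : v ∈ digit a (x ∘ m) n) : ∃ l, v ∈ simulate a m (initSeg x l, n) := by
  obtain ⟨t, h1, h2⟩ := mem_digit_iff_least.1 h
  refine ⟨t, mem_simulate.2 ⟨t, (length_initSeg x t).ge, ?_, fun t' ht' => ?_⟩⟩
  · rwa [reindexSeg_initSeg hm x (Nat.unpair_left_le t)]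
  · rw [reindexSeg_initSeg hm x ((Nat.unpair_left_le t').trans ht'.le)]
    exact h2 t' ht'

theorem mem_Phi {e : ℕ} {p r : Baire} : r ∈ Phi e p ↔ ∀ n, r n ∈ digit e p n := by
  constructor
  · rintro ⟨h, rfl⟩ n
    exact Part.get_mem (h n)
  · intro h
    exact ⟨fun n => (h n).1, funext fun n => (h n).2⟩

theorem exists_index_reindex {m : ℕ → ℕ} (hm : Primrec m) :
    ∃ e, ∀ x : Baire, (x ∘ m) ∈ Phi e x := by
  have hG : Partrec fun z : List ℕ × ℕ => (z.1[m z.2]? : Part ℕ) :=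
    Computable.ofOption
      (Primrec.list_getElem?.comp Primrec.fst (hm.comp Primrec.snd)).to_comp
  obtain ⟨e, he⟩ := exists_index (F := fun x n => Part.some (x (m n))) hG
    (fun x n l v hv => by
      simpa [eq_comm] using (mem_getElem_initSeg.1 (Part.mem_coe.1 hv)).2)
    (fun x n v hv => ⟨m n + 1, Part.mem_coe.2
      (mem_getElem_initSeg.2 ⟨Nat.lt_succ_self _, (Part.mem_some_iff.1 hv).symm⟩)⟩)
  exact ⟨e, fun x => mem_Phi.2 fun n => by rw [he]; exact Part.mem_some _⟩

/-- Composition with a reindexing on the input side and the successor on the output side. -/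
theorem exists_index_succ_comp_reindex (a : ℕ) {m : ℕ → ℕ} (hm : Primrec m) (hle : ∀ n, m n ≤ n) :
    ∃ e, ∀ x n, digit e x n = (digit a (x ∘ m) n).map Nat.succ := by
  refine exists_index ((partrec_simulate a hm).map (Computable.succ.comp Computable.snd).to₂) ?_ ?_
  · intro x n l v hv
    obtain ⟨w, hw, rfl⟩ := (Part.mem_map_iff _).1 hv
    exact Part.mem_map _ (simulate_sound hle hw)
  · intro x n v hv
    obtain ⟨w, hw, rfl⟩ := (Part.mem_map_iff _).1 hv
    obtain ⟨l, hl⟩ := simulate_complete hle hw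
    exact ⟨l, Part.mem_map _ hl⟩

/-- The functional whose even digits are `x ∘ k` and whose odd digits are those of the `a`-th
functional on `x ∘ m`. -/
theorem exists_index_join_reindex (a : ℕ) {k m : ℕ → ℕ} (hk : Primrec k) (hm : Primrec m)
    (hle : ∀ n, m n ≤ n) :
    ∃ e, ∀ x n, digit e x n =
      bif decide (n % 2 = 0) then Part.some (x (k (n / 2))) else digit a (x ∘ m) (n / 2) := by
  have hhalf : Primrec fun z : List ℕ × ℕ => z.2 / 2 :=
    Primrec.nat_div.comp Primrec.snd (Primrec.const 2)
  have hG : Partrec fun z : List ℕ × ℕ =>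
      bif decide (z.2 % 2 = 0) then (z.1[k (z.2 / 2)]? : Part ℕ)
        else simulate a m (z.1, z.2 / 2) := by
    refine Partrec.cond (Primrec.to_comp ?_) ?_ ?_
    · exact Primrec.eq.decide.comp (Primrec.nat_mod.comp Primrec.snd (Primrec.const 2))
        (Primrec.const 0)
    · exact Computable.ofOption
        (Primrec.list_getElem?.comp Primrec.fst (hk.comp hhalf)).to_comp
    · exact (partrec_simulate a hm).comp (Primrec.pair Primrec.fst hhalf).to_comp
  refine exists_index hG ?_ ?_
  · intro x n l v hv
    by_cases h : n % 2 = 0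
    · simp only [h, decide_true, cond_true, Part.mem_coe] at hv ⊢
      exact Part.mem_some_iff.2 (mem_getElem_initSeg.1 hv).2.symm
    · simp only [h, decide_false, cond_false] at hv ⊢
      exact simulate_sound hle hv
  · intro x n v hv
    by_cases h : n % 2 = 0
    · simp only [h, decide_true, cond_true, Part.mem_coe] at hv ⊢
      exact ⟨_, mem_getElem_initSeg.2 ⟨Nat.lt_succ_self _, (Part.mem_some_iff.1 hv).symm⟩⟩
    · simp only [h, decide_false, cond_false] at hv ⊢
      exact simulate_complete hle hv

/-! ### Joins and self-referential inputs -/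

theorem join_two_mul (p q : Baire) (n : ℕ) : join p q (2 * n) = p n := by simp [join]

theorem join_two_mul_add_one (p q : Baire) (n : ℕ) : join p q (2 * n + 1) = q n := by
  simp [join, Nat.add_mod, show (2 * n + 1) / 2 = n by omega]

theorem join_injective {p q p' q' : Baire} (h : join p q = join p' q') : p = p' ∧ q = q' :=
  ⟨funext fun n => by rw [← join_two_mul p q, h, join_two_mul],
    funext fun n => by rw [← join_two_mul_add_one p q, h, join_two_mul_add_one]⟩

/-- The sequence `a, b, p(0), p(1), …`. -/
def cons₂ (a b : ℕ) (p : Baire) : Baire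
  | 0 => a
  | 1 => b
  | n + 2 => p n

/-- Position map of `x ↦ x(0), x(1), x(0), x(1), x(2), …`. -/
def repeatHead (n : ℕ) : ℕ := if n < 2 then n else n - 2

theorem repeatHead_le (n : ℕ) : repeatHead n ≤ n := by unfold repeatHead; split <;> omega

theorem primrec_repeatHead : Primrec repeatHead :=
  Primrec.ite (Primrec.nat_lt.comp Primrec.id (Primrec.const 2)) Primrec.id
    (Primrec.nat_sub.comp Primrec.id (Primrec.const 2))

/-- For `x = (e, i, y)` this yields the jump input `(e, i, x)`, which replaces a fixed-point
argument. -/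
theorem comp_repeatHead (x : Baire) : x ∘ repeatHead = cons₂ (x 0) (x 1) x := by
  funext n
  match n with
  | 0 => rfl
  | 1 => rfl
  | n + 2 => simp [repeatHead, cons₂]

/-- Position map applying `repeatHead` to the even part of a sequence. -/
def repeatHeadEven (n : ℕ) : ℕ := if n % 2 = 0 then 2 * repeatHead (n / 2) else n

theorem repeatHeadEven_le (n : ℕ) : repeatHeadEven n ≤ n := by
  have := repeatHead_le (n / 2)
  unfold repeatHeadEven; split <;> omega

theorem primrec_repeatHeadEven : Primrec repeatHeadEven :=
  Primrec.ite (Primrec.eq.comp (Primrec.nat_mod.comp Primrec.id (Primrec.const 2))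
      (Primrec.const 0))
    (Primrec.nat_mul.comp (Primrec.const 2) (primrec_repeatHead.comp
      (Primrec.nat_div.comp Primrec.id (Primrec.const 2)))) Primrec.id

theorem join_comp_repeatHeadEven (p q : Baire) :
    join p q ∘ repeatHeadEven = join (p ∘ repeatHead) q := by
  funext n
  by_cases h : n % 2 = 0
  · simp [repeatHeadEven, join, h]
  · simp [repeatHeadEven, join, h]

/-! ### The tagged problem lies strictly below `g` -/

/-- The problem `g` with inputs accompanied by the fixed sequence `y`. -/
def tagged (y : Baire) (g : Problem) : Problem := fun x => {q | ∃ r, x = join y r ∧ q ∈ g r}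

theorem tagged_join (y r : Baire) (g : Problem) : tagged y g (join y r) = g r := by
  ext q
  constructor
  · rintro ⟨r', h, hq⟩
    rwa [(join_injective h).2]
  · exact fun hq => ⟨r, rfl, hq⟩

theorem tagged_reducible (y : Baire) (g : Problem) : Reducible (tagged y g) g := by
  have hodd : Primrec fun n : ℕ => 2 * n + 1 :=
    Primrec.succ.comp (Primrec.nat_mul.comp (Primrec.const 2) Primrec.id)
  obtain ⟨e, he⟩ := exists_index_reindex hodd
  have he' : ∀ p q, q ∈ Phi e (join p q) := fun p q => by
    have : (join p q ∘ fun n => 2 * n + 1) = q := funext (join_two_mul_add_one p q)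
    simpa only [this] using he (join p q)
  refine ⟨e, e, ?_⟩
  rintro _ ⟨q, r, rfl, hq⟩
  refine ⟨r, he' y r, ⟨q, hq⟩, fun q' hq' => ⟨q', he' _ q', ?_⟩⟩
  rwa [tagged_join]

/-- Diagonalization: `y` differs at place `e` from the even half of `Phi e r`. -/
theorem exists_not_computable_from (r : Baire) :
    ∃ y : Baire, ∀ e s, join y s ∉ Phi e r := by
  classical
  let y : Baire := fun e =>
    if h : ∃ z : Baire, ∃ s, join z s ∈ Phi e r then h.choose e + 1 else 0
  refine ⟨y, fun e s hs => ?_⟩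
  have h : ∃ z : Baire, ∃ s, join z s ∈ Phi e r := ⟨y, s, hs⟩
  obtain ⟨s', hs'⟩ := h.choose_spec
  have hy : y e = h.choose e + 1 := dif_pos h
  rw [(join_injective (Part.mem_unique hs hs')).1] at hy
  exact Nat.succ_ne_self _ hy.symm

theorem not_reducible_tagged {y r : Baire} {g : Problem} (hr : r ∈ dom g)
    (hy : ∀ e s, join y s ∉ Phi e r) : ¬ Reducible g (tagged y g) := by
  rintro ⟨e, i, h⟩
  obtain ⟨_, hx, ⟨q, s, rfl, hq⟩, -⟩ := h r hr
  exact hy e s hx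

/-! ### The jump of the tagged problem is not below `g` -/

theorem totJumpAt_nonempty (f : Problem) (e i : ℕ) (p : Baire) : (totJumpAt f e i p).Nonempty := by
  unfold totJumpAt
  split_ifs with h
  · obtain ⟨r, hr, ⟨q, hq⟩, hi⟩ := h
    exact ⟨_, r, hr, q, hq, Part.get_mem (hi q hq)⟩
  · exact Set.univ_nonempty

theorem not_totJump_tagged_reducible (y : Baire) (g : Problem) :
    ¬ Reducible (totJump (tagged y g)) g := by
  rintro ⟨a, b, h⟩
  obtain ⟨e, he⟩ := exists_index_join_reindex a (k := fun n => n + 2)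
    (Primrec.nat_add.comp Primrec.id (Primrec.const 2)) primrec_repeatHead repeatHead_le
  obtain ⟨i, hi⟩ := exists_index_succ_comp_reindex b primrec_repeatHeadEven repeatHeadEven_le
  -- The indices `e` and `i` depend only on `a` and `b`, so they can be written into the input.
  set p := cons₂ e i y
  set x := cons₂ e i p
  have hpx : p ∘ repeatHead = x := comp_repeatHead p
  obtain ⟨r, hr, hrg, hq⟩ := h x (totJumpAt_nonempty _ _ _ _)
  have her : join y r ∈ Phi e p := by
    refine mem_Phi.2 fun n => ?_
    rw [he, hpx]
    by_cases hn : n % 2 = 0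
    · simp [hn, join, p, cons₂]
    · simpa [hn, join] using mem_Phi.1 hr (n / 2)
  have hib : ∀ q s, s ∈ Phi b (join x q) → (fun n => s n + 1) ∈ Phi i (join p q) := by
    refine fun q s hs => mem_Phi.2 fun n => ?_
    rw [hi, join_comp_repeatHeadEven, hpx]
    exact Part.mem_map _ (mem_Phi.1 hs n)
  -- The first case of the jump applies: the assumed reduction itself guarantees `r ∈ dom g` and the
  -- convergence of `Phi b`.
  have hx : totJump (tagged y g) x =
      {z | ∃ r ∈ Phi e p, ∃ q ∈ tagged y g r, z ∈ Phi i (join p q)} := by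
    refine if_pos ⟨join y r, her, ?_, fun q hq' => ?_⟩
    · simpa only [dom, Set.mem_ofPred_eq, tagged_join] using hrg
    · rw [tagged_join] at hq'
      obtain ⟨s, hs, -⟩ := hq q hq'
      exact (hib q s hs).1
  have pred : ∀ q ∈ g r, ∀ s ∈ Phi b (join x q),
      ∃ q' ∈ g r, ∃ s' ∈ Phi b (join x q'), s 0 = s' 0 + 1 := by
    intro q hqr s hs
    obtain ⟨s₀, hs₀, hsx⟩ := hq q hqr
    rw [Part.mem_unique hs₀ hs, hx] at hsx
    obtain ⟨_, hr', q', hq', hz⟩ := hsx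
    rw [Part.mem_unique hr' her, tagged_join] at hq'
    obtain ⟨s', hs', -⟩ := hq q' hq'
    exact ⟨q', hq', s', hs', by rw [Part.mem_unique hz (hib q' s' hs')]⟩
  -- Descent on digit `0`: no answer can have a least first digit.
  have step : ∀ n, ∀ q ∈ g r, ∀ s ∈ Phi b (join x q), s 0 ≠ n := by
    intro n
    induction n with
    | zero =>
      intro q hqr s hs hs0
      obtain ⟨_, _, _, _, h⟩ := pred q hqr s hs
      omega
    | succ n ih =>
      intro q hqr s hs hs0
      obtain ⟨q', hq', s', hs', h⟩ := pred q hqr s hs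
      exact ih q' hq' s' hs' (by omega)
  obtain ⟨q, hqr⟩ := hrg
  obtain ⟨s, hs, -⟩ := hq q hqr
  exact step _ q hqr s hs rfl

end Weihrauch

theorem mainTheorem10 (g : Weihrauch.Problem) (hg : g ≠ Weihrauch.emptyProblem) :
    ∃ f : Weihrauch.Problem,
      Weihrauch.StrictReducible f g ∧ ¬ Weihrauch.Reducible (Weihrauch.totJump f) g := by
  obtain ⟨r, hr⟩ : ∃ r, r ∈ Weihrauch.dom g := by
    by_contra! h
    exact hg (funext fun r => Set.not_nonempty_iff_eq_empty.1 (h r))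
  obtain ⟨y, hy⟩ := Weihrauch.exists_not_computable_from r
  exact ⟨Weihrauch.tagged y g, ⟨Weihrauch.tagged_reducible y g,
    Weihrauch.not_reducible_tagged hr hy⟩, Weihrauch.not_totJump_tagged_reducible y g⟩
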